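/- Let $\Gamma$ be a finite connected distance-regular graph with vertex set $X$, path-length distance $\partial$, diameter $D\ge 3$, valencies $k_i=|\{z\in X:\partial(y,z)=i\}|$ $(0\le i\le D)$, distance matrices $A_i\in \mathrm{Mat}_X(\mathbb C)$ (with $(y,z)$-entry $1$ if $\partial(y,z)=i$ and $0$ otherwise), adjacency matrix $A=A_1$, and Bose–Mesner algebra $M=\mathrm{Span}(A_0,\dots,A_D)$. Let $\{E_i\}_{i=0}^D$ be an ordering of the primitive idempotents of $\Gamma$: a basis of $M$ with $E_0=|X|^{-1}J$ (where $J$ is the all-ones matrix), $\sum_i E_i=I$, $E_iE_j=\delta_{i,j}E_i$, and each $E_i$ real and symmetric. Define the eigenmatrices $P,Q$ by $A_j=\sum_i P_{i,j}E_i$ and $E_j=|X|^{-1}\sum_i Q_{i,j}A_i$. Assume that the ordering is formally self-dual, i.e. $P=Q$, and of $q$-Racah type: there are $q,a,\alpha,\varepsilon\in\mathbb C$ with $q,a,\alpha\neq 0$, $q^2\ne 1$, $q^2\neq -1$, such that $\theta_i:=P_{i,1}=Q_{i,1}$ satisfies $$\theta_i=\alpha(aq^{2i-D}+a^{-1}q^{D-2i})+\varepsilon\qquad(0\le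 i\le D).$$ For $x\in X$ let $E_i^*(x)$ be the diagonal matrix with $(y,y)$-entry $1$ if $\partial(x,y)=i$ and $0$ otherwise, and let $A^*(x)$ be the diagonal matrix with $(y,y)$-entry $|X|(E_1)_{x,y}$. Assume that for every $x\in X$, with $E_i^*=E_i^*(x)$ and $A^*=A^*(x)$, $$\sum_{i=0}^D E_i^*\,\frac{A-\varepsilon I}{\alpha}\,E_i^*\Bigl(1+\frac{\theta_i-\varepsilon}{\alpha}\frac1{q+q^{-1}}\Bigr)=\sum_{i=0}^D E_i\,\frac{A^*-\varepsilon I}{\alpha}\,E_i\Bigl(1+\frac{\theta_i-\varepsilon}{\alpha}\frac1{q+q^{-1}}\Bigr).$$ Put $\tau_i=(-1)^ia^{-i}q^{i(D-i)}$, let $0\ne f\in\mathbb C$, and define $\mathsf W=f\sum_{i=0}^D\tau_iE_i$. A matrix $W\in\mathrm{Mat}_X(\mathbb C)$ is a spin model if it is symmetric, has all entries nonzero, the matrix $W W^{(-)}$ with $W^{(-)}_{b,c}=1/W_{c,b}$ is a scalar multiple of $I$, and $$\sum_{e\in X}\frac{W_{e,b}W_{e,c}}{W_{e,a}}=|X|^{1/2}\frac{W_{b,c}}{W_{a,b}W_{c,a}}\qquad(a,b,c\in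 X).$$ For such a $W$, the Nomura algebra $N(W)$ consists of the symmetric matrices $B\in\mathrm{Mat}_X(\mathbb C)$ such that for all $b,c\in X$ the vector $u_{b,c}=(W_{y,b}/W_{y,c})_{y\in X}$ is an eigenvector of $B$. Assume that at least one of the following (equivalent) conditions holds: (i) $\mathsf W$ is a spin model; (ii) $f^2=|X|^{1/2}\sum_{i=0}^D\tau_i^{-1}k_i$. Then $\mathsf W$ is a spin model and $\mathsf W\in M\subseteq N(\mathsf W)$; that is, the spin model $\mathsf W$ is afforded by $\Gamma$. -/

import Mathlib

open scoped Matrix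

noncomputable section

section TypeII

variable {X : Type*} [Fintype X] [DecidableEq X]

/-- The matrix `W^(-)`, with `(a,b)`-entry `1 / W b a`. -/
def minusMatrix (W : Matrix X X ℂ) : Matrix X X ℂ :=
  Matrix.of fun a b => 1 / W b a

/-- `W` is type II: all entries are nonzero and `W W^(-)` is a scalar multiple of `I`. -/
structure IsTypeII (W : Matrix X X ℂ) : Prop where
  entry_ne_zero : ∀ a b, W a b ≠ 0
  mul_minus : W * minusMatrix W ∈ Submodule.span ℂ {(1 : Matrix X X ℂ)}

/-- `W` is a spin model: symmetric, type II, and type III (star-triangle). -/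
structure IsSpinModel (W : Matrix X X ℂ) : Prop where
  symmetric : Wᵀ = W
  typeII : IsTypeII W
  typeIII : ∀ a b c : X,
    ∑ e, W e b * W e c / W e a =
      (Real.sqrt (Fintype.card X : ℝ) : ℂ) * (W b c / (W a b * W c a))

/-- The vector `u_{b,c}`, with `y`-coordinate `W y b / W y c`. -/
def nomuraVector (W : Matrix X X ℂ) (b c : X) : X → ℂ :=
  fun y => W y b / W y c

/-- The Nomura algebra `N(W)` of a spin model `W`: the symmetric matrices `B` such that every
`u_{b,c}` is an eigenvector of `B`. (For a type II matrix `W` every `u_{b,c}` is nonzero.) -/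
def nomuraAlgebra (W : Matrix X X ℂ) : Submodule ℂ (Matrix X X ℂ) where
  carrier := {B | Bᵀ = B ∧ ∀ b c : X, ∃ t : ℂ, B *ᵥ nomuraVector W b c = t • nomuraVector W b c}
  zero_mem' := ⟨by simp, fun b c => ⟨0, by simp⟩⟩
  add_mem' := by
    rintro B B' ⟨hB, h⟩ ⟨hB', h'⟩
    refine ⟨by rw [Matrix.transpose_add, hB, hB'], fun b c => ?_⟩
    obtain ⟨s, hs⟩ := h b c
    obtain ⟨t, ht⟩ := h' b c
    exact ⟨s + t, by rw [Matrix.add_mulVec, hs, ht, add_smul]⟩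
  smul_mem' := by
    rintro r B ⟨hB, h⟩
    refine ⟨by rw [Matrix.transpose_smul, hB], fun b c => ?_⟩
    obtain ⟨s, hs⟩ := h b c
    exact ⟨r * s, by rw [Matrix.smul_mulVec, hs, mul_smul]⟩

end TypeII

section Graph

variable {X : Type*} [Fintype X] [DecidableEq X]

/-- `G` is a (connected) distance-regular graph with diameter `D` and intersection numbers
`p h i j = p^h_{i,j}` for `0 ≤ h, i, j ≤ D`. In particular `p 0 i i` is the valency `k_i`. -/
structure IsDistanceRegular (G : SimpleGraph X) (D : ℕ) (p : ℕ → ℕ → ℕ → ℕ) : Prop where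
  connected : G.Connected
  diam_eq : G.diam = D
  card_eq : ∀ h i j, h ≤ D → i ≤ D → j ≤ D → ∀ y z : X, G.dist y z = h →
    (Finset.univ.filter fun w : X => G.dist y w = i ∧ G.dist z w = j).card = p h i j

/-- The `i`th distance matrix `A_i`; in particular `distMatrix G 1` is the adjacency matrix. -/
def distMatrix (G : SimpleGraph X) (i : ℕ) : Matrix X X ℂ :=
  Matrix.of fun y z => if G.dist y z = i then 1 else 0

/-- The Bose-Mesner algebra `M` of a distance-regular graph, i.e. the span of the distance
matrices `A_0, …, A_D` where `D` is the diameter. -/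
def boseMesner (G : SimpleGraph X) : Submodule ℂ (Matrix X X ℂ) :=
  Submodule.span ℂ {B | ∃ i ≤ G.diam, B = distMatrix G i}

/-- `E 0, …, E D` is an ordering of the primitive idempotents of `G`. -/
structure IsPrimitiveIdempotents (G : SimpleGraph X) {D : ℕ}
    (E : Fin (D + 1) → Matrix X X ℂ) : Prop where
  linearIndependent : LinearIndependent ℂ E
  span_eq : Submodule.span ℂ (Set.range E) = boseMesner G
  zero_eq : E 0 = (Fintype.card X : ℂ)⁻¹ • Matrix.of fun _ _ => (1 : ℂ)
  sum_eq : ∑ i, E i = 1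
  transpose_eq : ∀ i, (E i)ᵀ = E i
  conj_eq : ∀ i, (E i).map (starRingEnd ℂ) = E i
  mul_eq : ∀ i j, E i * E j = if i = j then E i else 0

/-- `P` is the first eigenmatrix: `A_j = ∑ i, P_{i,j} E_i`. -/
def IsFirstEigenmatrix (G : SimpleGraph X) {D : ℕ} (E : Fin (D + 1) → Matrix X X ℂ)
    (P : Matrix (Fin (D + 1)) (Fin (D + 1)) ℂ) : Prop :=
  ∀ j : Fin (D + 1), distMatrix G j = ∑ i, P i j • E i

/-- `Q` is the second eigenmatrix: `E_j = |X|⁻¹ ∑ i, Q_{i,j} A_i`. -/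
def IsSecondEigenmatrix (G : SimpleGraph X) {D : ℕ} (E : Fin (D + 1) → Matrix X X ℂ)
    (Q : Matrix (Fin (D + 1)) (Fin (D + 1)) ℂ) : Prop :=
  ∀ j : Fin (D + 1),
    E j = (Fintype.card X : ℂ)⁻¹ • ∑ i : Fin (D + 1), Q i j • distMatrix G i

/-- The dual primitive idempotent `E*_i(x)`. -/
def dualIdempotent (G : SimpleGraph X) (x : X) (i : ℕ) : Matrix X X ℂ :=
  Matrix.diagonal fun y => if G.dist x y = i then 1 else 0

/-- The dual adjacency matrix `A*(x)`, diagonal with `(y,y)`-entry `|X| (E_1)_{x,y}`. -/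
def dualAdjacency {D : ℕ} (E : Fin (D + 1) → Matrix X X ℂ) (x : X) : Matrix X X ℂ :=
  Matrix.diagonal fun y => (Fintype.card X : ℂ) * E 1 x y

/-- The equation assumed at the base vertex `x`, with `θ i` the eigenvalue for `E i`:
`∑ E*_i ((A - ε)/α) E*_i (1 + ((θ_i - ε)/α) / (q + q⁻¹))
  = ∑ E_i ((A* - ε)/α) E_i (1 + ((θ_i - ε)/α) / (q + q⁻¹))`. -/
def BaseVertexEquation (G : SimpleGraph X) {D : ℕ} (E : Fin (D + 1) → Matrix X X ℂ)
    (θ : Fin (D + 1) → ℂ) (α ε q : ℂ) (x : X) : Prop :=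
  ∑ i : Fin (D + 1), (1 + (θ i - ε) / α * (1 / (q + q⁻¹))) •
      (dualIdempotent G x i * (α⁻¹ • (distMatrix G 1 - ε • 1)) * dualIdempotent G x i) =
    ∑ i : Fin (D + 1), (1 + (θ i - ε) / α * (1 / (q + q⁻¹))) •
      (E i * (α⁻¹ • (dualAdjacency E x - ε • 1)) * E i)

/-- The scalar `τ_i = (-1)^i a^{-i} q^{i(D-i)}`. -/
def tau (D : ℕ) (a q : ℂ) (i : ℕ) : ℂ :=
  (-1) ^ i * a ^ (-(i : ℤ)) * q ^ ((i : ℤ) * ((D : ℤ) - (i : ℤ)))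

/-- The matrix `W = f ∑ i, τ_i E_i`. -/
def boltzmannMatrix {D : ℕ} (E : Fin (D + 1) → Matrix X X ℂ) (a q f : ℂ) : Matrix X X ℂ :=
  f • ∑ i : Fin (D + 1), tau D a q i • E i

end Graph

end

/-! Fix a base vertex x. Let A and B be the adjacency and dual adjacency matrices after subtracting
ε and dividing by α, and put V = ∑ τ_i E_i, V* = ∑ τ_i E*_i. Since B is tridiagonal with respect to
the E_i and A with respect to the E*_i, the ratios of consecutive τ_i make V B V⁻¹ and (V*)⁻¹ A V*
each equal to a weighted diagonal part minus (qBA - q⁻¹AB)/(q² - q⁻²). The two diagonal parts are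
the two sides of the base vertex equation, so the conjugates agree and T = V*V satisfies AT = TB.
The eigenvalues are distinct, hence E_i T = T E*_i (`idem_mul_twist`).

The rest is read off from this. For i = 0 it makes column x of T constant, which forces V to have
entry κ τ_r⁻¹ at distance r (`sum_tau_mul_eigenmatrix`). Then u_{b,c} is a multiple of column b of
T(c), which is an eigenvector of every E_i, so M ⊆ N(W). Weighting by τ_i and summing gives VT =
TV*, whose entries are the star-triangle relation up to scale; condition (ii) says f²κ = |X|^{1/2},
the right scale. Type II follows from P = Q. -/

open scoped Matrix

/-! ### Scalar identities of q-Racah type -/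

theorem tau_ne_zero {D : ℕ} {a q : ℂ} (ha : a ≠ 0) (hq : q ≠ 0) (i : ℕ) : tau D a q i ≠ 0 := by
  exact mul_ne_zero (mul_ne_zero (pow_ne_zero _ (neg_ne_zero.mpr one_ne_zero))
    (zpow_ne_zero _ ha)) (zpow_ne_zero _ hq)

theorem tau_succ {D : ℕ} {a q : ℂ} (ha : a ≠ 0) (hq : q ≠ 0) (i : ℕ) :
    tau D a q (i + 1) = -(a * q ^ (2 * (i : ℤ) - D))⁻¹ * q⁻¹ * tau D a q i := by
  have h1 : ((i + 1 : ℕ) : ℤ) * ((D : ℤ) - ((i + 1 : ℕ) : ℤ))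
      = (i : ℤ) * ((D : ℤ) - i) + (-(2 * (i : ℤ) - D)) + (-1) := by push_cast; ring
  have h2 : -((i + 1 : ℕ) : ℤ) = -(i : ℤ) + (-1) := by push_cast; ring
  rw [tau, tau, h1, h2, zpow_add₀ hq, zpow_add₀ hq, zpow_add₀ ha, zpow_neg_one, zpow_neg_one,
    zpow_neg q, mul_inv, pow_succ]
  ring

/-- The eigenvalue `a q^{2i-D} + a⁻¹ q^{D-2i}` of `q`-Racah type. -/
noncomputable def qRacah (D : ℕ) (a q : ℂ) (i : ℕ) : ℂ :=
  a * q ^ (2 * (i : ℤ) - (D : ℤ)) + a⁻¹ * q ^ ((D : ℤ) - 2 * (i : ℤ))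

theorem qRacah_eq (D : ℕ) (a q : ℂ) (i : ℕ) :
    qRacah D a q i = a * q ^ (2 * (i : ℤ) - D) + (a * q ^ (2 * (i : ℤ) - D))⁻¹ := by
  rw [qRacah, mul_inv, ← zpow_neg, neg_sub]

theorem qRacah_succ {D : ℕ} {a q : ℂ} (hq : q ≠ 0) (i : ℕ) :
    qRacah D a q (i + 1) = a * q ^ (2 * (i : ℤ) - D) * q ^ 2
      + (a * q ^ (2 * (i : ℤ) - D))⁻¹ * (q ^ 2)⁻¹ := by
  have h : 2 * ((i + 1 : ℕ) : ℤ) - D = (2 * (i : ℤ) - D) + 2 := by push_cast; ring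
  rw [qRacah_eq, h, zpow_add₀ hq, mul_inv, mul_inv, mul_inv]
  norm_cast
  ring

/-- The coefficient on the `(i,j)`-block in the conjugation of a tridiagonal matrix by
`∑ τ_i E_i`. -/
noncomputable def blockCoeff (D : ℕ) (a q : ℂ) (i j : ℕ) : ℂ :=
  (if i = j then 1 + qRacah D a q i * (1 / (q + q⁻¹)) else 0)
    - (q ^ 2 - (q ^ 2)⁻¹)⁻¹ * (q * qRacah D a q j - q⁻¹ * qRacah D a q i)

/-- On the diagonal the coefficient is 1, because (q - q⁻¹)/(q² - q⁻²) = 1/(q + q⁻¹). Off it, with u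
= a q^{2i-D}, one of the terms in u and u⁻¹ cancels, leaving -uq at (i, i+1) and -(uq)⁻¹ at (i+1,
i): the ratios of consecutive τ's. -/
theorem blockCoeff_mul_tau {D : ℕ} {a q : ℂ} (ha : a ≠ 0) (hq : q ≠ 0) (hq1 : q ^ 2 ≠ 1)
    (hq2 : q ^ 2 ≠ -1) {i j : ℕ} (hij : i ≤ j + 1) (hji : j ≤ i + 1) :
    blockCoeff D a q i j * tau D a q j = tau D a q i := by
  have e1 : q ^ 2 - 1 ≠ 0 := sub_ne_zero.mpr hq1
  have e2 : q ^ 2 + 1 ≠ 0 := fun h => hq2 (eq_neg_of_add_eq_zero_left h)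
  have e3 : (q ^ 2 - (q ^ 2)⁻¹)⁻¹ = q ^ 2 / ((q ^ 2 - 1) * (q ^ 2 + 1)) := by
    rw [inv_eq_iff_eq_inv, inv_div]
    field_simp
    ring
  have e4 : 1 / (q + q⁻¹) = q / (q ^ 2 + 1) := by
    have : q + q⁻¹ = (q ^ 2 + 1) / q := by field_simp
    rw [this, one_div_div]
  rw [blockCoeff, e3, e4]
  obtain rfl | rfl | rfl : i = j ∨ j = i + 1 ∨ i = j + 1 := by omega
  · rw [if_pos rfl]
    generalize qRacah D a q i = t
    field_simp
    ring
  · rw [if_neg (by omega), qRacah_succ hq, tau_succ ha hq, qRacah_eq]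
    have hu : a * q ^ (2 * (i : ℤ) - D) ≠ 0 := mul_ne_zero ha (zpow_ne_zero _ hq)
    generalize a * q ^ (2 * (i : ℤ) - D) = u at hu
    field_simp
    ring
  · rw [if_neg (by omega), qRacah_succ hq, tau_succ ha hq, qRacah_eq]
    have hu : a * q ^ (2 * (j : ℤ) - D) ≠ 0 := mul_ne_zero ha (zpow_ne_zero _ hq)
    generalize a * q ^ (2 * (j : ℤ) - D) = u at hu
    field_simp
    ring

theorem eq_of_blocks_eq {R ι : Type*} [Ring R] [Fintype ι] {E : ι → R} (hsum : ∑ i, E i = 1)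
    {M N : R} (h : ∀ i j, E i * M * E j = E i * N * E j) : M = N := by
  have key : ∀ M : R, M = ∑ i, ∑ j, E i * M * E j := fun M => by
    simp_rw [← Finset.mul_sum, ← Finset.sum_mul, hsum, one_mul, mul_one]
  rw [key M, key N]
  simp_rw [h]

/-! ### Orthogonal idempotents and intertwiners -/

section Idempotents

variable {R ι : Type*} [Ring R] [Algebra ℂ R] [Fintype ι] [DecidableEq ι] {E : ι → R}

theorem idem_mul_sum (hmul : ∀ i j, E i * E j = if i = j then E i else 0) (c : ι → ℂ) (i : ι) :
    E i * ∑ j, c j • E j = c i • E i := by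
  simp [Finset.mul_sum, hmul]

theorem sum_mul_idem (hmul : ∀ i j, E i * E j = if i = j then E i else 0) (c : ι → ℂ) (i : ι) :
    (∑ j, c j • E j) * E i = c i • E i := by
  simp [Finset.sum_mul, hmul]

theorem idem_mul_diagPart_mul_idem (hmul : ∀ i j, E i * E j = if i = j then E i else 0)
    (c : ι → ℂ) (B : R) (i j : ι) :
    E i * (∑ k, c k • (E k * B * E k)) * E j = (if i = j then c i else 0) • (E i * B * E j) := by
  have : ∀ k, E i * (c k • (E k * B * E k)) * E j
      = if i = k then (if k = j then c k • (E k * B * E k) else 0) else 0 := by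
    intro k
    rw [mul_smul_comm, smul_mul_assoc, mul_assoc (E k) B, ← mul_assoc (E i), hmul]
    split_ifs with h1 h2
    · subst h1 h2
      rw [mul_assoc, mul_assoc, hmul, if_pos rfl]
    · subst h1
      rw [mul_assoc, mul_assoc, hmul, if_neg h2, mul_zero, mul_zero, smul_zero]
    · rw [zero_mul, zero_mul, smul_zero]
  rw [Finset.mul_sum, Finset.sum_mul]
  simp_rw [this]
  rw [Finset.sum_ite_eq, if_pos (Finset.mem_univ _)]
  split_ifs with h
  · subst h; rfl
  · rw [zero_smul]

/-- An intertwiner of two elements that have the same distinct eigenvalues also intertwines the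
corresponding primitive idempotents. -/
theorem idem_intertwine {E' : ι → R} (hmul : ∀ i j, E i * E j = if i = j then E i else 0)
    (hsum : ∑ i, E i = 1)
    (hmul' : ∀ i j, E' i * E' j = if i = j then E' i else 0) (hsum' : ∑ i, E' i = 1)
    {t : ι → ℂ} (ht : Function.Injective t) {T : R}
    (hT : (∑ i, t i • E i) * T = T * ∑ i, t i • E' i) (i : ι) : E i * T = T * E' i := by
  have off : ∀ i j, i ≠ j → E i * T * E' j = 0 := by
    intro i j hij
    have h := congrArg (fun Y => E i * Y * E' j) hT
    simp only [← mul_assoc] at h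
    rw [idem_mul_sum hmul, mul_assoc _ (∑ i, t i • E' i), sum_mul_idem hmul', smul_mul_assoc,
      smul_mul_assoc, mul_smul_comm, ← sub_eq_zero, ← sub_smul] at h
    exact (smul_eq_zero.mp h).resolve_left (sub_ne_zero.mpr fun e => hij (ht e))
  calc E i * T = ∑ j, E i * T * E' j := by rw [← Finset.mul_sum, hsum', mul_one]
    _ = E i * T * E' i := Finset.sum_eq_single i (fun j _ hj => off i j hj.symm) (by simp)
    _ = ∑ j, E j * T * E' i := (Finset.sum_eq_single (f := fun j => E j * T * E' i) i
        (fun j _ hj => off j i hj) (by simp)).symm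
    _ = T * E' i := by rw [← Finset.sum_mul, ← Finset.sum_mul, hsum, one_mul]

end Idempotents

/-! ### Conjugating a tridiagonal element by ∑ τ_i E_i -/

section Tridiagonal

variable {R : Type*} [Ring R] [Algebra ℂ R] {D : ℕ} {E : Fin (D + 1) → R}

theorem twist_mul_sum_tau (hmul : ∀ i j, E i * E j = if i = j then E i else 0)
    (hsum : ∑ i, E i = 1) {a q : ℂ} (ha : a ≠ 0) (hq : q ≠ 0) (hq1 : q ^ 2 ≠ 1)
    (hq2 : q ^ 2 ≠ -1) {A B : R} (hA : A = ∑ i : Fin (D + 1), qRacah D a q i • E i)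
    (htri : ∀ i j : Fin (D + 1), ¬((i : ℕ) ≤ j + 1 ∧ (j : ℕ) ≤ i + 1) → E i * B * E j = 0) :
    (∑ i : Fin (D + 1), (1 + qRacah D a q i * (1 / (q + q⁻¹))) • (E i * B * E i)
        - (q ^ 2 - (q ^ 2)⁻¹)⁻¹ • (q • (B * A) - q⁻¹ • (A * B)))
      * ∑ i : Fin (D + 1), tau D a q i • E i
      = (∑ i : Fin (D + 1), tau D a q i • E i) * B := by
  refine eq_of_blocks_eq hsum fun i j => ?_
  have h1 : E i * (B * A) * E j = qRacah D a q j • (E i * B * E j) := by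
    rw [hA, mul_assoc, mul_assoc, sum_mul_idem hmul, mul_smul_comm, mul_smul_comm, mul_assoc]
  have h2 : E i * (A * B) * E j = qRacah D a q i • (E i * B * E j) := by
    rw [hA, ← mul_assoc, idem_mul_sum hmul, smul_mul_assoc, smul_mul_assoc]
  rw [mul_assoc, mul_assoc, sum_mul_idem hmul, mul_smul_comm, mul_smul_comm, ← mul_assoc,
    ← mul_assoc (E i) _ B, idem_mul_sum hmul, smul_mul_assoc, smul_mul_assoc, mul_sub, sub_mul,
    idem_mul_diagPart_mul_idem hmul, mul_smul_comm, smul_mul_assoc, mul_sub, sub_mul,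
    mul_smul_comm, mul_smul_comm, smul_mul_assoc, smul_mul_assoc, h1, h2]
  by_cases hc : (i : ℕ) ≤ j + 1 ∧ (j : ℕ) ≤ i + 1
  · rw [← blockCoeff_mul_tau ha hq hq1 hq2 hc.1 hc.2, blockCoeff]
    simp only [Fin.ext_iff]
    module
  · simp [htri i j hc]

/-- Mirror image of `twist_mul_sum_tau`, with AB and BA exchanged so that swapping the roles of A
and B reproduces the same q-commutator there. -/
theorem sum_tau_mul_twist (hmul : ∀ i j, E i * E j = if i = j then E i else 0)
    (hsum : ∑ i, E i = 1) {a q : ℂ} (ha : a ≠ 0) (hq : q ≠ 0) (hq1 : q ^ 2 ≠ 1)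
    (hq2 : q ^ 2 ≠ -1) {A B : R} (hA : A = ∑ i : Fin (D + 1), qRacah D a q i • E i)
    (htri : ∀ i j : Fin (D + 1), ¬((i : ℕ) ≤ j + 1 ∧ (j : ℕ) ≤ i + 1) → E i * B * E j = 0) :
    (∑ i : Fin (D + 1), tau D a q i • E i) *
      (∑ i : Fin (D + 1), (1 + qRacah D a q i * (1 / (q + q⁻¹))) • (E i * B * E i)
        - (q ^ 2 - (q ^ 2)⁻¹)⁻¹ • (q • (A * B) - q⁻¹ • (B * A)))
      = B * ∑ i : Fin (D + 1), tau D a q i • E i := by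
  refine eq_of_blocks_eq hsum fun i j => ?_
  have h1 : E i * (B * A) * E j = qRacah D a q j • (E i * B * E j) := by
    rw [hA, mul_assoc, mul_assoc, sum_mul_idem hmul, mul_smul_comm, mul_smul_comm, mul_assoc]
  have h2 : E i * (A * B) * E j = qRacah D a q i • (E i * B * E j) := by
    rw [hA, ← mul_assoc, idem_mul_sum hmul, smul_mul_assoc, smul_mul_assoc]
  rw [← mul_assoc, idem_mul_sum hmul, smul_mul_assoc, smul_mul_assoc, ← mul_assoc (E i) B,
    mul_assoc (E i * B) _ (E j), sum_mul_idem hmul, mul_smul_comm, mul_sub,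
    sub_mul, idem_mul_diagPart_mul_idem hmul, mul_smul_comm, smul_mul_assoc, mul_sub, sub_mul,
    mul_smul_comm, mul_smul_comm, smul_mul_assoc, smul_mul_assoc, h1, h2]
  by_cases hc : (i : ℕ) ≤ j + 1 ∧ (j : ℕ) ≤ i + 1
  · rw [← blockCoeff_mul_tau ha hq hq1 hq2 hc.2 hc.1, blockCoeff]
    simp only [Fin.ext_iff]
    by_cases h : (i : ℕ) = j
    · rw [if_pos h, if_pos h.symm, h]
      module
    · rw [if_neg h, if_neg (Ne.symm h)]
      module
  · simp [htri i j hc]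

end Tridiagonal

/-! ### Distances and distance matrices -/

section Distances

variable {X : Type*} [Fintype X] {G : SimpleGraph X} {D : ℕ}
  {p : ℕ → ℕ → ℕ → ℕ}

theorem IsDistanceRegular.dist_le (hG : IsDistanceRegular G D p) (y z : X) : G.dist y z ≤ D := by
  have := hG.connected.nonempty
  rw [← hG.diam_eq]
  exact SimpleGraph.dist_le_diam (SimpleGraph.connected_iff_ediam_ne_top.mp hG.connected)

/-- The distance between two vertices, as an index. -/
noncomputable def IsDistanceRegular.dist (hG : IsDistanceRegular G D p) (y z : X) : Fin (D + 1) :=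
  ⟨G.dist y z, Nat.lt_succ_of_le (hG.dist_le y z)⟩

theorem IsDistanceRegular.dist_eq_iff (hG : IsDistanceRegular G D p) (y z : X)
    (i : Fin (D + 1)) : G.dist y z = i ↔ hG.dist y z = i := by
  rw [Fin.ext_iff]; rfl

theorem IsDistanceRegular.dist_comm (hG : IsDistanceRegular G D p) (y z : X) :
    hG.dist y z = hG.dist z y :=
  Fin.ext G.dist_comm

theorem IsDistanceRegular.dist_self (hG : IsDistanceRegular G D p) (y : X) :
    hG.dist y y = 0 :=
  Fin.ext G.dist_self

theorem IsDistanceRegular.exists_dist_eq (hG : IsDistanceRegular G D p) {i : ℕ} (hi : i ≤ D) :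
    ∃ y z : X, G.dist y z = i := by
  have := hG.connected.nonempty
  obtain ⟨u, v, huv⟩ := G.exists_dist_eq_diam
  rw [hG.diam_eq] at huv
  obtain ⟨w, hw⟩ := hG.connected.exists_walk_length_eq_dist u v
  -- The i-th vertex of a geodesic joining a diametral pair.
  refine ⟨u, w.getVert i, ?_⟩
  have h1 := SimpleGraph.dist_le (w.take i)
  have h2 := SimpleGraph.dist_le (w.drop i)
  have h3 := hG.connected.dist_triangle (u := u) (v := w.getVert i) (w := v)
  rw [SimpleGraph.Walk.take_length] at h1
  rw [SimpleGraph.Walk.drop_length] at h2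
  omega

theorem IsDistanceRegular.card_dist_eq (hG : IsDistanceRegular G D p) (x : X)
    (i : Fin (D + 1)) : (Finset.univ.filter fun y => hG.dist x y = i).card = p 0 i i := by
  rw [← hG.card_eq 0 i i (Nat.zero_le _) i.is_le i.is_le x x G.dist_self]
  simp only [hG.dist_eq_iff, and_self]

theorem IsDistanceRegular.intersection_one_eq_zero (hG : IsDistanceRegular G D p) (hD : 1 ≤ D)
    {i j : ℕ} (hi : i ≤ D) (hj : j ≤ D) (hij : ¬(i ≤ j + 1 ∧ j ≤ i + 1)) : p 1 i j = 0 := by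
  obtain ⟨y, z, hyz⟩ := hG.exists_dist_eq hD
  rw [← hG.card_eq 1 i j hD hi hj y z hyz, Finset.card_eq_zero, Finset.filter_eq_empty_iff]
  rintro w - ⟨rfl, rfl⟩
  refine hij ⟨?_, ?_⟩
  · have := hG.connected.dist_triangle (u := y) (v := z) (w := w)
    omega
  · have := hG.connected.dist_triangle (u := z) (v := y) (w := w)
    rw [G.dist_comm (u := z) (v := y)] at this
    omega

theorem distMatrix_one_eq_adjMatrix {X : Type*} (G : SimpleGraph X) [DecidableRel G.Adj] :
    distMatrix G 1 = G.adjMatrix ℂ := by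
  ext y z
  simp [distMatrix, SimpleGraph.adjMatrix_apply, SimpleGraph.dist_eq_one_iff_adj]

theorem distMatrix_one_pow_apply_eq_zero [DecidableEq X] (G : SimpleGraph X) {k : ℕ} {y z : X}
    (h : k < G.dist y z) : (distMatrix G 1 ^ k) y z = 0 := by
  classical
  rw [distMatrix_one_eq_adjMatrix, SimpleGraph.adjMatrix_pow_apply_eq_card_walk, Nat.cast_eq_zero,
    Fintype.card_eq_zero_iff]
  exact ⟨fun w => absurd (SimpleGraph.dist_le w.1) (by rw [w.2]; omega)⟩

theorem distMatrix_one_pow_dist_apply_ne_zero [DecidableEq X] (hG : G.Connected) (y z : X) :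
    (distMatrix G 1 ^ G.dist y z) y z ≠ 0 := by
  classical
  rw [distMatrix_one_eq_adjMatrix, SimpleGraph.adjMatrix_pow_apply_eq_card_walk, Nat.cast_ne_zero]
  obtain ⟨w, hw⟩ := hG.exists_walk_length_eq_dist y z
  have : Nonempty {w : G.Walk y z | w.length = G.dist y z} := ⟨⟨w, hw⟩⟩
  exact Fintype.card_ne_zero

theorem IsDistanceRegular.distMatrix_mul (hG : IsDistanceRegular G D p) (i j : Fin (D + 1)) :
    distMatrix G i * distMatrix G j = ∑ m : Fin (D + 1), (p m i j : ℂ) • distMatrix G m := by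
  ext y z
  rw [Matrix.mul_apply, Matrix.sum_apply]
  simp only [distMatrix, Matrix.of_apply, Matrix.smul_apply, smul_eq_mul, mul_ite, mul_one,
    mul_zero, ← ite_and]
  rw [Finset.sum_boole]
  simp only [hG.dist_eq_iff y z]
  rw [Finset.sum_ite_eq, if_pos (Finset.mem_univ _)]
  rw [← hG.card_eq (hG.dist y z) i j (Fin.is_le _) i.is_le j.is_le y z rfl]
  congr 2
  ext w
  simp only [Finset.mem_filter, G.dist_comm (u := w) (v := z), and_comm]

end Distances

/-! ### Dual idempotents -/

section DualIdempotents

variable {X : Type*} [Fintype X] [DecidableEq X] {G : SimpleGraph X} {D : ℕ}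
  {p : ℕ → ℕ → ℕ → ℕ}

theorem dualIdempotent_mul (G : SimpleGraph X) (x : X) (i j : Fin (D + 1)) :
    dualIdempotent G x i * dualIdempotent G x j = if i = j then dualIdempotent G x i else 0 := by
  rw [dualIdempotent, dualIdempotent, Matrix.diagonal_mul_diagonal]
  split_ifs with h
  · subst h; simp
  · rw [← Matrix.diagonal_zero, Matrix.diagonal_eq_diagonal_iff]
    intro y
    by_cases hy : G.dist x y = i
    · rw [if_neg (c := G.dist x y = j) (fun h' => h (Fin.ext (hy.symm.trans h'))), mul_zero]
    · rw [if_neg hy, zero_mul]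

theorem IsDistanceRegular.sum_smul_dualIdempotent (hG : IsDistanceRegular G D p) (x : X)
    (c : Fin (D + 1) → ℂ) :
    ∑ i : Fin (D + 1), c i • dualIdempotent G x i = Matrix.diagonal fun y => c (hG.dist x y) := by
  ext y z
  rw [Matrix.sum_apply]
  simp only [dualIdempotent, Matrix.smul_apply, Matrix.diagonal_apply, hG.dist_eq_iff]
  split_ifs <;> simp

theorem IsDistanceRegular.sum_dualIdempotent (hG : IsDistanceRegular G D p) (x : X) :
    ∑ i : Fin (D + 1), dualIdempotent G x i = 1 := by
  simpa using hG.sum_smul_dualIdempotent x fun _ => 1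

theorem IsDistanceRegular.dualIdempotent_mul_distMatrix_one_mul (hG : IsDistanceRegular G D p)
    (x : X) {i j : ℕ} (hij : ¬(i ≤ j + 1 ∧ j ≤ i + 1)) :
    dualIdempotent G x i * distMatrix G 1 * dualIdempotent G x j = 0 := by
  ext y z
  rw [dualIdempotent, dualIdempotent, Matrix.mul_diagonal, Matrix.diagonal_mul, distMatrix,
    Matrix.of_apply, Matrix.zero_apply]
  by_cases h1 : G.dist x y = i
  · by_cases h2 : G.dist x z = j
    · rw [if_neg (c := G.dist y z = 1), mul_zero, zero_mul]
      intro h3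
      have h4 := hG.connected.dist_triangle (u := x) (v := y) (w := z)
      have h5 := hG.connected.dist_triangle (u := x) (v := z) (w := y)
      rw [G.dist_comm (u := z)] at h5
      omega
    · rw [if_neg h2, mul_zero]
  · rw [if_neg h1, zero_mul, zero_mul]

end DualIdempotents

/-! ### Eigenvalues, self-duality and Krein vanishing -/

section Eigenmatrices

variable {X : Type*} [Fintype X] [DecidableEq X] {G : SimpleGraph X} {D : ℕ}
  {p : ℕ → ℕ → ℕ → ℕ} {E : Fin (D + 1) → Matrix X X ℂ}
  {P : Matrix (Fin (D + 1)) (Fin (D + 1)) ℂ}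

theorem IsPrimitiveIdempotents.aeval_sum_smul (hE : IsPrimitiveIdempotents G E)
    (t : Fin (D + 1) → ℂ) (g : Polynomial ℂ) :
    Polynomial.aeval (∑ i, t i • E i) g = ∑ i, g.eval (t i) • E i := by
  have hpow : ∀ n : ℕ, (∑ i, t i • E i) ^ n = ∑ i, t i ^ n • E i := by
    intro n
    induction n with
    | zero => simp [hE.sum_eq]
    | succ n ih =>
      rw [pow_succ, ih, Finset.sum_mul]
      refine Finset.sum_congr rfl fun i _ => ?_
      rw [smul_mul_assoc, idem_mul_sum hE.mul_eq, smul_smul, pow_succ]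
  induction g using Polynomial.induction_on' with
  | add g₁ g₂ h₁ h₂ => simp only [map_add, h₁, h₂, Polynomial.eval_add, add_smul,
      Finset.sum_add_distrib]
  | monomial n c =>
    rw [Polynomial.aeval_monomial, hpow, ← Algebra.smul_def, Finset.smul_sum]
    simp [smul_smul]

/-- The eigenvalues of a distance-regular graph of diameter `D` are distinct. -/
theorem IsPrimitiveIdempotents.eigenvalue_injective (hG : IsDistanceRegular G D p)
    (hE : IsPrimitiveIdempotents G E) {t : Fin (D + 1) → ℂ}
    (ht : distMatrix G 1 = ∑ i, t i • E i) : Function.Injective t := by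
  classical
  by_contra hinj
  set S := Finset.univ.image t with hS
  have hcard : S.card ≤ D := by
    have h1 : S.card ≤ D + 1 := by simpa using Finset.card_image_le (s := Finset.univ) (f := t)
    refine Nat.le_of_lt_succ (lt_of_le_of_ne h1 fun h => hinj ?_)
    have := Finset.injOn_of_card_image_eq (s := Finset.univ) (f := t) (by simpa using h)
    simpa using this
  set g : Polynomial ℂ := ∏ s ∈ S, (Polynomial.X - Polynomial.C s) with hg
  have hdeg : g.natDegree = S.card := Polynomial.natDegree_finsetProd_X_sub_C_eq_card S id
  have hmonic : g.Monic := Polynomial.monic_prod_X_sub_C id S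
  have h0 : Polynomial.aeval (distMatrix G 1) g = 0 := by
    rw [ht, hE.aeval_sum_smul]
    refine Finset.sum_eq_zero fun i _ => ?_
    rw [hg, Polynomial.eval_prod, Finset.prod_eq_zero (i := t i) (by simp [hS]) (by simp),
      zero_smul]
  -- At vertices whose distance is the degree of g, only the leading power of the adjacency matrix
  -- has a nonzero entry, contradicting g(A) = 0.
  obtain ⟨y, z, hyz⟩ := hG.exists_dist_eq hcard
  have h1 := congrFun (congrFun h0 y) z
  rw [Polynomial.aeval_eq_sum_range, hdeg, Finset.sum_range_succ, Matrix.add_apply,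
    Matrix.sum_apply, Finset.sum_eq_zero, zero_add, ← hdeg, hmonic.coeff_natDegree, one_smul,
    hdeg, ← hyz] at h1
  · exact distMatrix_one_pow_dist_apply_ne_zero hG.connected y z h1
  · intro k hk
    rw [Matrix.smul_apply, distMatrix_one_pow_apply_eq_zero G (by
      rw [hyz]; exact Finset.mem_range.mp hk), smul_zero]

omit [DecidableEq X] in
theorem IsSecondEigenmatrix.apply (hG : IsDistanceRegular G D p)
    (hQ : IsSecondEigenmatrix G E P) (j : Fin (D + 1)) (y z : X) :
    E j y z = (Fintype.card X : ℂ)⁻¹ * P (hG.dist y z) j := by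
  rw [hQ j, Matrix.smul_apply, Matrix.sum_apply]
  simp only [distMatrix, Matrix.smul_apply, Matrix.of_apply, hG.dist_eq_iff]
  simp

theorem IsFirstEigenmatrix.mul_eq_sum (hG : IsDistanceRegular G D p)
    (hE : IsPrimitiveIdempotents G E) (hP : IsFirstEigenmatrix G E P) (r i j : Fin (D + 1)) :
    P r i * P r j = ∑ m : Fin (D + 1), (p m i j : ℂ) * P r m := by
  have h := congrArg (E r * ·) (hG.distMatrix_mul i j)
  simp only [Finset.mul_sum, mul_smul_comm, ← mul_assoc] at h
  simp only [hP _, idem_mul_sum hE.mul_eq, smul_mul_assoc] at h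
  simp only [smul_smul, ← Finset.sum_smul] at h
  exact smul_left_injective ℂ (hE.linearIndependent.ne_zero r) h

/-- For a formally self-dual ordering the Krein parameters equal the intersection numbers. -/
theorem IsPrimitiveIdempotents.apply_mul_apply (hG : IsDistanceRegular G D p)
    (hE : IsPrimitiveIdempotents G E) (hP : IsFirstEigenmatrix G E P)
    (hQ : IsSecondEigenmatrix G E P) (i j : Fin (D + 1)) (y z : X) :
    E i y z * E j y z =
      (Fintype.card X : ℂ)⁻¹ * ∑ m : Fin (D + 1), (p m i j : ℂ) * E m y z := by
  simp only [hQ.apply hG]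
  rw [mul_mul_mul_comm, hP.mul_eq_sum hG hE, Finset.mul_sum, Finset.mul_sum]
  exact Finset.sum_congr rfl fun m _ => by ring

open scoped ComplexOrder in
-- The squared Frobenius norm of E_i A* E_j expands, through the entrywise product of E_i and E_j,
-- into a combination of the (x,x)-entries of E_1 E_m E_1 with coefficients |X| p^m_{i,j}. Only m =
-- 1 survives, and its coefficient is zero.
theorem IsPrimitiveIdempotents.idem_mul_dualAdjacency_mul_idem (hG : IsDistanceRegular G D p)
    (hE : IsPrimitiveIdempotents G E) (hP : IsFirstEigenmatrix G E P)
    (hQ : IsSecondEigenmatrix G E P) (x : X) {i j : Fin (D + 1)}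
    (hij : p (1 : Fin (D + 1)) i j = 0) : E i * dualAdjacency E x * E j = 0 := by
  have hH : ∀ k, (E k)ᴴ = E k := fun k => by
    rw [Matrix.conjTranspose, hE.transpose_eq]; exact hE.conj_eq k
  have hsymm : ∀ k y z, E k y z = E k z y := fun k y z =>
    congrFun (congrFun (hE.transpose_eq k) z) y
  have hstar : ∀ k y z, star (E k y z) = E k y z :=
    fun k y z => congrFun (congrFun (hE.conj_eq k) y) z
  have hdH : (dualAdjacency E x)ᴴ = dualAdjacency E x := by
    rw [dualAdjacency, Matrix.diagonal_conjTranspose]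
    congr 1
    ext y
    simp [hstar]
  rw [← Matrix.trace_mul_conjTranspose_self_eq_zero_iff, Matrix.conjTranspose_mul,
    Matrix.conjTranspose_mul, hH, hH, hdH]
  have h1 : E i * dualAdjacency E x * E j * (E j * (dualAdjacency E x * E i))
      = (E i * dualAdjacency E x * E j) * dualAdjacency E x * E i := by
    have hjj := hE.mul_eq j j
    rw [if_pos rfl] at hjj
    simp only [← mul_assoc]
    rw [mul_assoc (E i * dualAdjacency E x) (E j) (E j), hjj]
  have h2 : E i * (E i * dualAdjacency E x * E j * dualAdjacency E x)
      = (E i * dualAdjacency E x) * (E j * dualAdjacency E x) := by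
    have hii := hE.mul_eq i i
    rw [if_pos rfl] at hii
    simp only [← mul_assoc, hii]
  rw [h1, Matrix.trace_mul_comm, h2, Matrix.trace]
  have h3 : ∀ y z, (E i * dualAdjacency E x) y z * (E j * dualAdjacency E x) z y
      = ∑ m : Fin (D + 1), (Fintype.card X : ℂ) * p m i j * (E 1 x y * E m y z * E 1 z x) := by
    intro y z
    have hn : (Fintype.card X : ℂ) ≠ 0 := by
      have : Nonempty X := ⟨x⟩
      exact Nat.cast_ne_zero.mpr Fintype.card_ne_zero
    rw [dualAdjacency, Matrix.mul_diagonal, Matrix.mul_diagonal, hsymm j z y, hsymm 1 x z]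
    calc E i y z * (Fintype.card X * E 1 z x) * (E j y z * (Fintype.card X * E 1 x y))
        = (Fintype.card X) ^ 2 * (E 1 z x * E 1 x y) * (E i y z * E j y z) := by ring
      _ = _ := by
        rw [hE.apply_mul_apply hG hP hQ, Finset.mul_sum, Finset.mul_sum]
        refine Finset.sum_congr rfl fun m _ => ?_
        field_simp
  simp only [Matrix.diag_apply, Matrix.mul_apply (M := E i * dualAdjacency E x), h3]
  simp_rw [Finset.sum_comm (t := (Finset.univ : Finset (Fin (D + 1))))]
  refine Finset.sum_eq_zero fun m _ => ?_
  simp_rw [← Finset.mul_sum]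
  by_cases hm : m = 1
  · subst hm
    rw [hij, Nat.cast_zero, mul_zero, zero_mul]
  · have h4 : ∑ y, ∑ z, E 1 x y * E m y z * E 1 z x = (E 1 * E m * E 1) x x := by
      simp only [Matrix.mul_apply, Finset.sum_mul]
      exact Finset.sum_comm
    rw [h4, hE.mul_eq, if_neg (Ne.symm hm), zero_mul, Matrix.zero_apply, mul_zero]

end Eigenmatrices

/-! ### The intertwiner V*V -/

section Twist

variable {X : Type*} [Fintype X] [DecidableEq X] {G : SimpleGraph X} {D : ℕ}
  {p : ℕ → ℕ → ℕ → ℕ} {E : Fin (D + 1) → Matrix X X ℂ}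
  {P : Matrix (Fin (D + 1)) (Fin (D + 1)) ℂ} {q a α ε : ℂ}

theorem inv_smul_sum_smul_sub {R ι : Type*} [Ring R] [Algebra ℂ R] [Fintype ι] {F : ι → R}
    (hsum : ∑ i, F i = 1) (hα : α ≠ 0) (c : ι → ℂ) :
    α⁻¹ • (∑ i, (α * c i + ε) • F i - ε • (1 : R)) = ∑ i, c i • F i := by
  rw [← hsum, Finset.smul_sum, ← Finset.sum_sub_distrib, Finset.smul_sum]
  refine Finset.sum_congr rfl fun i _ => ?_
  rw [← sub_smul, add_sub_cancel_right, smul_smul, inv_mul_cancel_left₀ hα]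

theorem mul_inv_smul_sub_mul_eq_zero {R : Type*} [Ring R] [Algebra ℂ R] {F F' B : R}
    (h : F * B * F' = 0) (h' : F * F' = 0) : F * (α⁻¹ • (B - ε • (1 : R))) * F' = 0 := by
  simp [mul_sub, sub_mul, h, h']

/-- The product `W*(x) W` (up to a scalar) intertwines `E*_i(x)` and `E_i`. -/
theorem idem_mul_twist (hD : 1 ≤ D) (hG : IsDistanceRegular G D p)
    (hE : IsPrimitiveIdempotents G E) (hP : IsFirstEigenmatrix G E P)
    (hQ : IsSecondEigenmatrix G E P) (hq : q ≠ 0) (hq1 : q ^ 2 ≠ 1) (hq2 : q ^ 2 ≠ -1)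
    (ha : a ≠ 0) (hα : α ≠ 0)
    (hθ : ∀ i : Fin (D + 1), P i 1 = α * qRacah D a q i + ε) {x : X}
    (hZ : BaseVertexEquation G E (fun i => P i 1) α ε q x) (i : Fin (D + 1)) :
    E i * ((∑ i : Fin (D + 1), tau D a q i • dualIdempotent G x i) *
        ∑ i : Fin (D + 1), tau D a q i • E i)
      = ((∑ i : Fin (D + 1), tau D a q i • dualIdempotent G x i) *
        ∑ i : Fin (D + 1), tau D a q i • E i) * dualIdempotent G x i := by
  -- The numeral 1 in `Fin (D + 1)` would be 0 if D were 0.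
  have hone : ((1 : Fin (D + 1)) : ℕ) = 1 := by
    obtain ⟨d, rfl⟩ := Nat.exists_eq_add_of_le' hD
    rfl
  have hA1 : distMatrix G 1 = ∑ i, P i 1 • E i := by
    have := hP 1
    rwa [hone] at this
  have hinj : Function.Injective fun i : Fin (D + 1) => qRacah D a q i := by
    intro i j hij
    refine hE.eigenvalue_injective hG hA1 ?_
    simp only [hθ]
    rw [show qRacah D a q i = qRacah D a q j from hij]
  have hdual : dualAdjacency E x = ∑ i : Fin (D + 1), P i 1 • dualIdempotent G x i := by
    have hn : (Fintype.card X : ℂ) ≠ 0 := by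
      have : Nonempty X := ⟨x⟩
      exact Nat.cast_ne_zero.mpr Fintype.card_ne_zero
    rw [hG.sum_smul_dualIdempotent, dualAdjacency]
    congr 1
    ext y
    rw [hQ.apply hG, mul_inv_cancel_left₀ hn]
  have hA : α⁻¹ • (distMatrix G 1 - ε • 1) = ∑ i : Fin (D + 1), qRacah D a q i • E i := by
    rw [hA1]
    simp only [hθ]
    exact inv_smul_sum_smul_sub hE.sum_eq hα _
  have hB : α⁻¹ • (dualAdjacency E x - ε • 1)
      = ∑ i : Fin (D + 1), qRacah D a q i • dualIdempotent G x i := by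
    rw [hdual]
    simp only [hθ]
    exact inv_smul_sum_smul_sub (hG.sum_dualIdempotent x) hα _
  have htri : ∀ i j : Fin (D + 1), ¬((i : ℕ) ≤ j + 1 ∧ (j : ℕ) ≤ i + 1) →
      E i * (α⁻¹ • (dualAdjacency E x - ε • 1)) * E j = 0 := by
    intro i j hij
    refine mul_inv_smul_sub_mul_eq_zero (hE.idem_mul_dualAdjacency_mul_idem hG hP hQ x ?_) ?_
    · rw [hone]
      exact hG.intersection_one_eq_zero hD i.is_le j.is_le hij
    · rw [hE.mul_eq, if_neg]
      rintro rfl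
      omega
  have htri' : ∀ i j : Fin (D + 1), ¬((i : ℕ) ≤ j + 1 ∧ (j : ℕ) ≤ i + 1) →
      dualIdempotent G x i * (α⁻¹ • (distMatrix G 1 - ε • 1)) * dualIdempotent G x j = 0 := by
    intro i j hij
    refine mul_inv_smul_sub_mul_eq_zero (hG.dualIdempotent_mul_distMatrix_one_mul x hij) ?_
    rw [dualIdempotent_mul, if_neg]
    rintro rfl
    omega
  have hscalar : ∀ i : Fin (D + 1), (P i 1 - ε) / α = qRacah D a q i := by
    intro i
    rw [hθ, add_sub_cancel_right, mul_div_cancel_left₀ _ hα]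
  unfold BaseVertexEquation at hZ
  simp only [hscalar] at hZ
  have h1 := twist_mul_sum_tau hE.mul_eq hE.sum_eq ha hq hq1 hq2 hA htri
  have h2 := sum_tau_mul_twist (dualIdempotent_mul G x) (hG.sum_dualIdempotent x) ha hq hq1 hq2
    hB htri'
  -- This makes the twisted factor in `h2` identical to that in `h1`.
  rw [hZ] at h2
  refine idem_intertwine hE.mul_eq hE.sum_eq (dualIdempotent_mul G x) (hG.sum_dualIdempotent x)
    hinj ?_ i
  rw [← hA, ← hB, ← mul_assoc, ← h2, mul_assoc, h1, mul_assoc]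

end Twist

/-! ### Entries of ∑ τ_i E_i -/

section Entries

variable {X : Type*} [Fintype X] [DecidableEq X] {G : SimpleGraph X} {D : ℕ}
  {p : ℕ → ℕ → ℕ → ℕ} {E : Fin (D + 1) → Matrix X X ℂ}
  {P : Matrix (Fin (D + 1)) (Fin (D + 1)) ℂ} {q a : ℂ}

theorem IsPrimitiveIdempotents.zero_mul_apply (hE : IsPrimitiveIdempotents G E)
    (M : Matrix X X ℂ) (y z : X) :
    (E 0 * M) y z = (Fintype.card X : ℂ)⁻¹ * ∑ w, M w z := by
  rw [hE.zero_eq, smul_mul_assoc, Matrix.smul_apply, Matrix.mul_apply]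
  simp

theorem tau_zero (D : ℕ) (a q : ℂ) : tau D a q 0 = 1 := by
  simp [tau]

omit [DecidableEq X] in
theorem IsSecondEigenmatrix.sum_smul_apply (hG : IsDistanceRegular G D p)
    (hQ : IsSecondEigenmatrix G E P) (c : Fin (D + 1) → ℂ) (y z : X) :
    (∑ i, c i • E i) y z = (Fintype.card X : ℂ)⁻¹ * ∑ i, c i * P (hG.dist y z) i := by
  rw [Matrix.sum_apply, Finset.mul_sum]
  refine Finset.sum_congr rfl fun i _ => ?_
  rw [Matrix.smul_apply, hQ.apply hG, smul_eq_mul]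
  ring

/-- The entries of `∑ τ_i E_i` are proportional to `τ_i⁻¹`. -/
theorem sum_tau_mul_eigenmatrix (hG : IsDistanceRegular G D p)
    (hE : IsPrimitiveIdempotents G E) (hQ : IsSecondEigenmatrix G E P) (ha : a ≠ 0)
    (hq : q ≠ 0)
    (hR : ∀ x : X, ∀ i : Fin (D + 1),
      E i * ((∑ i : Fin (D + 1), tau D a q i • dualIdempotent G x i) *
        ∑ i : Fin (D + 1), tau D a q i • E i)
      = ((∑ i : Fin (D + 1), tau D a q i • dualIdempotent G x i) *
        ∑ i : Fin (D + 1), tau D a q i • E i) * dualIdempotent G x i) :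
    ∃ κ : ℂ, κ * ∑ i : Fin (D + 1), (tau D a q i)⁻¹ * (p 0 i i : ℂ) = 1 ∧
      ∀ r : Fin (D + 1), (Fintype.card X : ℂ)⁻¹ * ∑ i : Fin (D + 1), tau D a q i * P r i
        = κ * (tau D a q r)⁻¹ := by
  set w : Fin (D + 1) → ℂ := fun r =>
    (Fintype.card X : ℂ)⁻¹ * ∑ i : Fin (D + 1), tau D a q i * P r i with hw
  have hent : ∀ y z, (∑ i : Fin (D + 1), tau D a q i • E i) y z = w (hG.dist y z) :=
    hQ.sum_smul_apply hG _
  have hcol : ∀ x y z : X, tau D a q (hG.dist x y) * w (hG.dist y x)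
      = tau D a q (hG.dist x z) * w (hG.dist z x) := by
    intro x y z
    set T := (∑ i : Fin (D + 1), tau D a q i • dualIdempotent G x i) *
        ∑ i : Fin (D + 1), tau D a q i • E i with hT
    have hTent : ∀ y, T y x = tau D a q (hG.dist x y) * w (hG.dist y x) := by
      intro y
      rw [hT, hG.sum_smul_dualIdempotent, Matrix.diagonal_mul, hent]
    -- The case i = 0: E_0 averages columns, while E*_0(x) fixes column x.
    have hconst : ∀ y, T y x = (Fintype.card X : ℂ)⁻¹ * ∑ v, T v x := by
      intro y
      rw [← hE.zero_mul_apply T y x, hR x 0, dualIdempotent, Matrix.mul_diagonal]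
      simp [hT]
    rw [← hTent, ← hTent, hconst y, hconst z]
  have hwr : ∀ r, w r = w 0 * (tau D a q r)⁻¹ := by
    intro r
    obtain ⟨x, y, hxy⟩ := hG.exists_dist_eq r.is_le
    rw [hG.dist_eq_iff] at hxy
    have h := hcol x y x
    rw [hG.dist_self, hG.dist_comm y x, hxy, Fin.val_zero, tau_zero, one_mul] at h
    rw [← h]
    field_simp [tau_ne_zero ha hq (r : ℕ)]
  refine ⟨w 0, ?_, hwr⟩
  obtain ⟨x⟩ := hG.connected.nonempty
  have hn : (Fintype.card X : ℂ) ≠ 0 := by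
    have : Nonempty X := ⟨x⟩
    exact Nat.cast_ne_zero.mpr Fintype.card_ne_zero
  -- Column sums of V are 1 because E_0 V = τ_0 E_0 = E_0; this normalises κ.
  have h1 : ∑ y, (∑ i : Fin (D + 1), tau D a q i • E i) y x = 1 := by
    have h2 := hE.zero_mul_apply (∑ i : Fin (D + 1), tau D a q i • E i) x x
    rw [idem_mul_sum hE.mul_eq, Fin.val_zero, tau_zero, one_smul, hE.zero_eq] at h2
    simp only [Matrix.smul_apply, Matrix.of_apply, smul_eq_mul] at h2
    exact (mul_left_cancel₀ (inv_ne_zero hn) h2).symm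
  rw [← h1, Finset.mul_sum]
  have h3 : ∀ i : Fin (D + 1), (p 0 i i : ℂ)
      = ∑ y, if hG.dist x y = i then (1 : ℂ) else 0 := by
    intro i
    rw [Finset.sum_boole, hG.card_dist_eq]
  simp_rw [h3, Finset.mul_sum]
  rw [Finset.sum_comm]
  refine Finset.sum_congr rfl fun y _ => ?_
  rw [hent, hG.dist_comm y x, hwr (hG.dist x y)]
  simp

end Entries

/-! ### The spin model and its Nomura algebra -/

theorem lemma14p3 {X : Type*} [Fintype X] [DecidableEq X] (G : SimpleGraph X)
    (D : ℕ) (hD : 3 ≤ D) (p : ℕ → ℕ → ℕ → ℕ) (hG : IsDistanceRegular G D p)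
    (E : Fin (D + 1) → Matrix X X ℂ) (hE : IsPrimitiveIdempotents G E)
    (P Q : Matrix (Fin (D + 1)) (Fin (D + 1)) ℂ)
    (hP : IsFirstEigenmatrix G E P) (hQ : IsSecondEigenmatrix G E Q)
    (hPQ : P = Q)
    (q a α ε : ℂ) (hq : q ≠ 0) (hq1 : q ^ 2 ≠ 1) (hq2 : q ^ 2 ≠ -1)
    (ha : a ≠ 0) (hα : α ≠ 0)
    (hθ : ∀ i : Fin (D + 1),
      P i 1 = α * (a * q ^ (2 * (i : ℤ) - (D : ℤ)) + a⁻¹ * q ^ ((D : ℤ) - 2 * (i : ℤ))) + ε)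
    (hZ : ∀ x : X, BaseVertexEquation G E (fun i => P i 1) α ε q x)
    (f : ℂ) (hf : f ≠ 0)
    (h : IsSpinModel (boltzmannMatrix E a q f) ∨
      f ^ 2 = (Real.sqrt (Fintype.card X : ℝ) : ℂ) *
        ∑ i : Fin (D + 1), (tau D a q i)⁻¹ * (p 0 i i : ℂ)) :
    IsSpinModel (boltzmannMatrix E a q f) ∧
      boltzmannMatrix E a q f ∈ boseMesner G ∧
      boseMesner G ≤ nomuraAlgebra (boltzmannMatrix E a q f) := by
  subst hPQ
  have hR := fun x => idem_mul_twist (by omega) hG hE hP hQ hq hq1 hq2 ha hα hθ (hZ x)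
  obtain ⟨κ, hκ, hw⟩ := sum_tau_mul_eigenmatrix hG hE hQ ha hq hR
  have hκ0 : κ ≠ 0 := left_ne_zero_of_mul_eq_one hκ
  have hτ := fun i => tau_ne_zero (D := D) ha hq i
  have hn : (Fintype.card X : ℂ) ≠ 0 := by
    have := hG.connected.nonempty
    exact Nat.cast_ne_zero.mpr Fintype.card_ne_zero
  set V := ∑ i : Fin (D + 1), tau D a q i • E i with hV
  have hVent : ∀ y z, V y z = κ * (tau D a q (hG.dist y z))⁻¹ := fun y z => by
    rw [hV, hQ.sum_smul_apply hG, hw]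
  have hW : boltzmannMatrix E a q f = f • V := rfl
  have hWent : ∀ y z, boltzmannMatrix E a q f y z = f * (κ * (tau D a q (hG.dist y z))⁻¹) :=
    fun y z => by rw [hW, Matrix.smul_apply, hVent, smul_eq_mul]
  set T : X → Matrix X X ℂ := fun x =>
    (∑ i : Fin (D + 1), tau D a q i • dualIdempotent G x i) * V with hT
  have hTent : ∀ x y z, T x y z = tau D a q (hG.dist x y) * V y z := fun x y z => by
    rw [hT]
    dsimp only
    rw [hG.sum_smul_dualIdempotent, Matrix.diagonal_mul]
  have hu : ∀ b c, nomuraVector (boltzmannMatrix E a q f) b c = κ⁻¹ • (T c).col b := by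
    intro b c
    ext y
    rw [nomuraVector, hWent, hWent, Pi.smul_apply, Matrix.col_apply, hTent, hVent, hG.dist_comm c y,
      smul_eq_mul]
    have := hτ (hG.dist y b)
    have := hτ (hG.dist y c)
    field_simp
  have hsymm : Vᵀ = V := by
    rw [hV, Matrix.transpose_sum]
    simp [hE.transpose_eq]
  refine ⟨?_, ?_, ?_⟩
  · refine h.elim id fun hf2 => ⟨?_, ⟨?_, ?_⟩, ?_⟩
    · rw [hW, Matrix.transpose_smul, hsymm]
    · intro y z
      rw [hWent]
      exact mul_ne_zero hf (mul_ne_zero hκ0 (inv_ne_zero (hτ _)))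
    · have hminus : minusMatrix (boltzmannMatrix E a q f)
          = (f * κ)⁻¹ • ∑ i : Fin (D + 1), tau D a q i • distMatrix G i := by
        ext y z
        rw [minusMatrix, Matrix.of_apply, hWent, Matrix.smul_apply, Matrix.sum_apply,
          hG.dist_comm z y]
        simp only [Matrix.smul_apply, distMatrix, Matrix.of_apply, hG.dist_eq_iff, smul_eq_mul,
          mul_ite, mul_one, mul_zero]
        rw [Finset.sum_ite_eq, if_pos (Finset.mem_univ _)]
        have := hτ (hG.dist y z)
        field_simp
      -- Self-duality: the sums over P that give the entries of V also give the eigenvalues of ∑ τ_i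
      -- A_i, which are therefore proportional to τ_r⁻¹, inverse to those of V.
      have hdual : ∑ i : Fin (D + 1), tau D a q i • distMatrix G i
          = ∑ r : Fin (D + 1), (Fintype.card X * (κ * (tau D a q r)⁻¹)) • E r := by
        simp only [hP _, Finset.smul_sum, smul_smul]
        rw [Finset.sum_comm]
        refine Finset.sum_congr rfl fun r _ => ?_
        rw [← Finset.sum_smul, ← hw r, mul_inv_cancel_left₀ hn]
      have hinv : V * ∑ r : Fin (D + 1), (Fintype.card X * (κ * (tau D a q r)⁻¹)) • E r
          = (Fintype.card X * κ) • (1 : Matrix X X ℂ) := by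
        rw [hV, Finset.sum_mul, ← hE.sum_eq, Finset.smul_sum]
        refine Finset.sum_congr rfl fun i _ => ?_
        rw [smul_mul_assoc, idem_mul_sum hE.mul_eq, smul_smul]
        congr 1
        have := hτ i
        field_simp
      rw [hminus, hdual, hW, smul_mul_smul_comm, hinv, smul_smul]
      exact Submodule.smul_mem _ _ (Submodule.mem_span_singleton_self _)
    · have hf2κ : f ^ 2 * κ = (Real.sqrt (Fintype.card X : ℝ) : ℂ) := by
        rw [hf2, mul_assoc, mul_comm _ κ, hκ, mul_one]
      intro x b c
      -- The (c,b)-entry of this identity is the star-triangle relation for x, b, c up to scale.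
      have hVT : V * T x = T x * ∑ i : Fin (D + 1), tau D a q i • dualIdempotent G x i := by
        rw [Finset.mul_sum]
        conv_lhs => rw [hV, Finset.sum_mul]
        refine Finset.sum_congr rfl fun i _ => ?_
        rw [smul_mul_assoc, mul_smul_comm, hR x i]
      have hsum : ∀ e, boltzmannMatrix E a q f e b * boltzmannMatrix E a q f e c
            / boltzmannMatrix E a q f e x = f * κ⁻¹ * (V c e * T x e b) := by
        intro e
        rw [hWent, hWent, hWent, hTent, hVent, hVent, hG.dist_comm c e, hG.dist_comm x e]
        have := hτ (hG.dist e x)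
        have := hτ (hG.dist e b)
        have := hτ (hG.dist e c)
        field_simp
      simp only [hsum]
      rw [← Finset.mul_sum, ← Matrix.mul_apply, hVT, hG.sum_smul_dualIdempotent,
        Matrix.mul_diagonal, hTent, hVent, ← hf2κ, hWent, hWent, hWent, hG.dist_comm c b,
        hG.dist_comm c x]
      have := hτ (hG.dist x b)
      have := hτ (hG.dist x c)
      have := hτ (hG.dist b c)
      field_simp
  · rw [hW, ← hE.span_eq]
    exact Submodule.smul_mem _ _ (Submodule.sum_mem _ fun i _ =>
      Submodule.smul_mem _ _ (Submodule.subset_span ⟨i, rfl⟩))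
  · rw [← hE.span_eq, Submodule.span_le]
    rintro _ ⟨i, rfl⟩
    -- Right multiplication by E*_i(c) keeps column b exactly when b is at distance i from c, so the
    -- eigenvalue is 1 or 0 accordingly.
    refine ⟨hE.transpose_eq i, fun b c => ⟨if hG.dist c b = i then 1 else 0, ?_⟩⟩
    have hcol : E i *ᵥ (T c).col b = (if hG.dist c b = i then (1 : ℂ) else 0) • (T c).col b := by
      ext y
      have h1 := congrFun (congrFun (hR c i) y) b
      rw [dualIdempotent, Matrix.mul_diagonal] at h1
      simp only [hG.dist_eq_iff] at h1
      rw [Pi.smul_apply, smul_eq_mul, mul_comm]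
      exact h1
    rw [hu, Matrix.mulVec_smul, hcol, smul_comm]
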